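/- Let $n$ be a positive integer and let $k$ be a complex number with $k\neq -1$. Complex powers are principal values, $\sec v=1/\cos v$, $\operatorname{csch}x=1/\sinh x$, and $\zeta$ is the (analytically continued) Riemann zeta function. Then $$\sum_{j=1}^{n}j^{k}=\frac{n^{k+1}}{k+1}+\frac{n^{k}}{2}+\zeta(-k)+\frac{\pi\,n^{k+2}}{k+1}\int_{0}^{\pi/2}\bigl(\sec v\,\operatorname{csch}(\pi n\tan v)\bigr)^2\left(1-\frac{\cos((k+1)v)}{(\cos v)^{k+1}}\right)dv ,$$ and equivalently $$\sum_{j=1}^{n}j^{k}=\frac{n^{k+1}}{k+1}+\frac{n^{k}}{2}+\zeta(-k)-\frac{2\pi\,n^{k+2}}{k+1}\int_{0}^{\infty}\left(-2+(1+ix)^{k+1}+(1-ix)^{k+1}\right)\frac{e^{-2\pi nx}}{\left(1-e^{-2\pi nx}\right)^2}\,dx ,$$ where both integrals converge absolutely. -/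

import Mathlib

namespace GenFaulhaber

/-- The secant `1 / cos v`. -/
noncomputable def sec (v : ℝ) : ℝ := 1 / Real.cos v

/-- The hyperbolic cosecant `1 / sinh x`. -/
noncomputable def csch (x : ℝ) : ℝ := 1 / Real.sinh x

/-- The trigonometric integrand
`(sec v · csch (π n tan v))² (1 - cos ((k+1) v) / (cos v)^(k+1))`. -/
noncomputable def trigIntegrand (n : ℕ) (k : ℂ) (v : ℝ) : ℂ :=
  (((sec v * csch (Real.pi * n * Real.tan v)) ^ 2 : ℝ) : ℂ) *
    (1 - Complex.cos ((k + 1) * (v : ℂ)) / ((Real.cos v : ℝ) : ℂ) ^ (k + 1))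

/-- The exponential integrand
`(-2 + (1 + i x)^(k+1) + (1 - i x)^(k+1)) · e^(-2 π n x) / (1 - e^(-2 π n x))²`,
with principal powers. -/
noncomputable def expIntegrand (n : ℕ) (k : ℂ) (x : ℝ) : ℂ :=
  (-2 + (1 + Complex.I * (x : ℂ)) ^ (k + 1) + (1 - Complex.I * (x : ℂ)) ^ (k + 1)) *
    ((Real.exp (-2 * Real.pi * n * x) / (1 - Real.exp (-2 * Real.pi * n * x)) ^ 2 : ℝ) : ℂ)

end GenFaulhaber

/-! Put s = -k with Re s > 1. Up to the factor Γ(s), the zeta tail over j ≥ n is the Mellin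
transform of e^(-nt)/(1 - e^(-t)). Write 1/(1 - e^(-t)) = 1/t + 1/2 + r(t). The first two terms give
n^(k+1)/(k+1) and n^k/2. The cotangent partial fractions give r(t) as a series, which makes
t·r(t)/(2πn) the integral of 2 - 2cos(ntx) against the exponential weight
(`integral_one_sub_cos_mul_expWeight`). By Fubini the t-integral comes first; it is a Gamma integral
with scales n and n(1 ± ix), which produces the powers (1 ± ix)^(k+1)
(`integral_doubleIntegrand_fst`).

This proves the exponential formula for Re k < -1. Both sides are holomorphic on the connected set k
≠ -1, because the integral is dominated locally uniformly in k (`exists_norm_expIntegrand_le`), so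
the identity theorem extends it. The substitution x = tan v then gives the trigonometric form. -/

open MeasureTheory Set Filter Topology

namespace GenFaulhaber

/-! ### Holomorphic parameter integrals -/

/-- A locally dominated family of holomorphic functions has a holomorphic integral. -/
theorem differentiableAt_integral_of_dominated {α : Type*} [MeasurableSpace α] {μ : Measure α}
    {F : ℂ → α → ℂ} {z : ℂ} {r : ℝ} (hr : 0 < r) {bound : α → ℝ}
    (hmeas : ∀ w ∈ Metric.ball z r, AEStronglyMeasurable (F w) μ)
    (hdiff : ∀ᵐ a ∂μ, DifferentiableOn ℂ (fun w ↦ F w a) (Metric.ball z r))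
    (hbound : ∀ᵐ a ∂μ, ∀ w ∈ Metric.ball z r, ‖F w a‖ ≤ bound a)
    (hint : Integrable bound μ) :
    DifferentiableAt ℂ (fun w ↦ ∫ a, F w a ∂μ) z := by
  have hr4 : 0 < r / 4 := by positivity
  have hz : z ∈ Metric.ball z r := Metric.mem_ball_self hr
  have hsub : ∀ w ∈ Metric.ball z (r / 4), Metric.closedBall w (r / 4) ⊆ Metric.ball z r := by
    intro w hw u hu
    rw [Metric.mem_ball] at hw ⊢
    rw [Metric.mem_closedBall] at hu
    linarith [dist_triangle u w z]
  refine (hasDerivAt_integral_of_dominated_loc_of_deriv_le (F' := fun w a ↦ deriv (fun u ↦ F u a) w)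
    (bound := fun a ↦ bound a / (r / 4)) (Metric.ball_mem_nhds z hr4) ?_ ?_ ?_ ?_
    (hint.div_const _) ?_).2.differentiableAt
  · filter_upwards [Metric.ball_mem_nhds z hr] with w hw using hmeas w hw
  · refine hint.mono' (hmeas z hz) ?_
    filter_upwards [hbound] with a ha using ha z hz
  -- The derivative is measurable in `a` as a pointwise limit of difference quotients along a null
  -- sequence of nonzero steps.
  · set c : ℕ → ℂ := fun m ↦ ((r / 2 / ((m : ℝ) + 1) : ℝ) : ℂ) with hc
    have hcpos : ∀ m : ℕ, 0 < r / 2 / ((m : ℝ) + 1) := fun m ↦ by positivity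
    have hc0 : ∀ m, c m ≠ 0 := fun m ↦ by
      exact Complex.ofReal_ne_zero.mpr (hcpos m).ne'
    have hcmem : ∀ m, z + c m ∈ Metric.ball z r := by
      intro m
      rw [Metric.mem_ball, dist_eq_norm, add_sub_cancel_left, hc, Complex.norm_real,
        Real.norm_of_nonneg (hcpos m).le]
      have : r / 2 / ((m : ℝ) + 1) ≤ r / 2 :=
        div_le_self (by positivity) (by linarith [Nat.cast_nonneg (α := ℝ) m])
      linarith
    have hct : Tendsto c atTop (𝓝[≠] 0) := by
      refine tendsto_nhdsWithin_iff.mpr ⟨?_, Eventually.of_forall hc0⟩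
      have h : Tendsto (fun m : ℕ ↦ r / 2 / ((m : ℝ) + 1)) atTop (𝓝 0) :=
        tendsto_const_nhds.div_atTop (tendsto_atTop_add_const_right _ _ tendsto_natCast_atTop_atTop)
      have h' := (Complex.continuous_ofReal.tendsto 0).comp h
      rwa [Complex.ofReal_zero] at h'
    refine aestronglyMeasurable_of_tendsto_ae atTop
      (f := fun m a ↦ (c m)⁻¹ • (F (z + c m) a - F z a)) ?_ ?_
    · intro m
      exact ((hmeas _ (hcmem m)).sub (hmeas z hz)).const_smul (c m)⁻¹
    · filter_upwards [hdiff] with a ha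
      have hd : HasDerivAt (fun u ↦ F u a) (deriv (fun u ↦ F u a) z) z :=
        (ha.differentiableAt (Metric.ball_mem_nhds z hr)).hasDerivAt
      exact (hasDerivAt_iff_tendsto_slope_zero.mp hd).comp hct
  -- Cauchy's estimate on the circle of radius r/4 about `w`, which stays inside the ball of radius
  -- r.
  · filter_upwards [hdiff, hbound] with a ha hb w hw
    refine Complex.norm_deriv_le_of_forall_mem_sphere_norm_le hr4 ?_ fun u hu ↦
      hb u (hsub w hw (Metric.sphere_subset_closedBall hu))
    exact (ha.mono (hsub w hw)).diffContOnCl_ball subset_rfl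
  · filter_upwards [hdiff] with a ha w hw
    refine (ha.differentiableAt (Metric.isOpen_ball.mem_nhds ?_)).hasDerivAt
    exact hsub w hw (Metric.mem_closedBall_self hr4.le)

/-! ### Polar form and bounds for (1 + ix)^w + (1 - ix)^w - 2 -/

theorem norm_exp_sub_one_le_mul_exp (z : ℂ) : ‖Complex.exp z - 1‖ ≤ ‖z‖ * Real.exp ‖z‖ := by
  simpa using Complex.norm_exp_sub_sum_le_norm_mul_exp z 1

/-- The linear Taylor terms of e^(iz) and e^(-iz) cancel, leaving two second-order remainders. -/
theorem norm_cos_sub_one_le_mul_exp (z : ℂ) :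
    ‖Complex.cos z - 1‖ ≤ ‖z‖ ^ 2 * Real.exp ‖z‖ := by
  have h1 := Complex.norm_exp_sub_sum_le_norm_mul_exp (z * Complex.I) 2
  have h2 := Complex.norm_exp_sub_sum_le_norm_mul_exp (-z * Complex.I) 2
  simp only [Finset.sum_range_succ, Finset.sum_range_zero, norm_mul, norm_neg, Complex.norm_I,
    mul_one] at h1 h2
  have h : Complex.cos z - 1 =
      ((Complex.exp (z * Complex.I) -
          (0 + (z * Complex.I) ^ 0 / (Nat.factorial 0 : ℕ) +
            (z * Complex.I) ^ 1 / (Nat.factorial 1 : ℕ))) +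
        (Complex.exp (-z * Complex.I) -
          (0 + (-z * Complex.I) ^ 0 / (Nat.factorial 0 : ℕ) +
            (-z * Complex.I) ^ 1 / (Nat.factorial 1 : ℕ)))) / 2 := by
    simp [Complex.cos]
    ring
  rw [h, norm_div, Complex.norm_ofNat, div_le_iff₀ (by norm_num)]
  exact (norm_add_le _ _).trans (by linarith)

/-- Polar form: 1 + i tan v = e^(iv)/cos v, with cos v > 0 and v within the principal range of the
argument. -/
theorem log_one_add_I_mul_tan {v : ℝ} (hv : v ∈ Ioo (-(Real.pi / 2)) (Real.pi / 2)) :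
    Complex.log (1 + Complex.I * (Real.tan v : ℝ)) =
      ((-Real.log (Real.cos v) : ℝ) : ℂ) + v * Complex.I := by
  have hc : 0 < Real.cos v := Real.cos_pos_of_mem_Ioo hv
  have hc' : (Real.cos v : ℂ) ≠ 0 := by exact_mod_cast hc.ne'
  have h : 1 + Complex.I * (Real.tan v : ℝ) =
      (((Real.cos v)⁻¹ : ℝ) : ℂ) * Complex.exp (v * Complex.I) := by
    rw [Complex.exp_mul_I, Real.tan_eq_sin_div_cos, ← Complex.ofReal_cos, ← Complex.ofReal_sin]
    push_cast at hc' ⊢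
    field_simp
  rw [h, Complex.log_ofReal_mul (inv_pos.mpr hc) (Complex.exp_ne_zero _), Real.log_inv,
    Complex.log_exp]
  · simp; linarith [hv.1, Real.pi_pos]
  · simp; linarith [hv.2, Real.pi_pos]

theorem one_add_I_mul_ne_zero (x : ℝ) : (1 + Complex.I * (x : ℂ)) ≠ 0 := by
  intro h
  simpa using congrArg Complex.re h

theorem one_sub_I_mul_ne_zero (x : ℝ) : (1 - Complex.I * (x : ℂ)) ≠ 0 := by
  intro h
  simpa using congrArg Complex.re h

theorem cpow_add_cpow_tan {v : ℝ} (hv : v ∈ Ioo (-(Real.pi / 2)) (Real.pi / 2)) (w : ℂ) :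
    (1 + Complex.I * (Real.tan v : ℝ)) ^ w + (1 - Complex.I * (Real.tan v : ℝ)) ^ w =
      2 * (Complex.exp (w * ((-Real.log (Real.cos v) : ℝ) : ℂ)) * Complex.cos (w * v)) := by
  have hv' : -v ∈ Ioo (-(Real.pi / 2)) (Real.pi / 2) := ⟨by linarith [hv.2], by linarith [hv.1]⟩
  have h2 := log_one_add_I_mul_tan hv'
  rw [Real.tan_neg, Real.cos_neg, Complex.ofReal_neg, mul_neg, ← sub_eq_add_neg] at h2
  rw [Complex.cpow_def_of_ne_zero (one_add_I_mul_ne_zero _),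
    Complex.cpow_def_of_ne_zero (one_sub_I_mul_ne_zero _), log_one_add_I_mul_tan hv, h2,
    add_mul, add_mul, Complex.exp_add, Complex.exp_add, Complex.cos]
  push_cast
  rw [show (v : ℂ) * Complex.I * w = w * v * Complex.I by ring,
    show -(v : ℂ) * Complex.I * w = -(w * v) * Complex.I by ring, mul_comm w (-_)]
  ring

theorem neg_log_cos_arctan (x : ℝ) :
    -Real.log (Real.cos (Real.arctan x)) = Real.log (Real.sqrt (1 + x ^ 2)) := by
  rw [Real.cos_arctan, one_div, Real.log_inv, neg_neg]

/-- The numerator of the exponential integrand vanishes to second order at the origin and grows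
subexponentially, locally uniformly in the exponent. -/
theorem exists_norm_cpow_add_cpow_sub_two_le {R : ℝ} (hR : 0 < R) :
    ∃ K : ℝ, 0 ≤ K ∧ ∀ w : ℂ, ‖w‖ ≤ R → ∀ x : ℝ, 0 < x →
      ‖-2 + (1 + Complex.I * (x : ℂ)) ^ w + (1 - Complex.I * (x : ℂ)) ^ w‖ ≤
        K * (x ^ 2 * Real.exp x) := by
  -- With v = arctan x and L = log √(1 + x²), the exponential of Rπ/2 bounds e^(|w|v), and the last
  -- factor is the constant in e^(RL) ≤ C e^x.
  refine ⟨2 * (R ^ 2 * Real.exp (R * (Real.pi / 2)) + R) * Real.exp (1 - R + R * Real.log R),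
    by positivity, ?_⟩
  intro w hw x hx
  set v := Real.arctan x with hvdef
  set L := Real.log (Real.sqrt (1 + x ^ 2)) with hL
  have hvmem : v ∈ Ioo (-(Real.pi / 2)) (Real.pi / 2) := Real.arctan_mem_Ioo x
  have hv0 : 0 < v := Real.arctan_pos.mpr hx
  have hvx : v ≤ x := by
    have := Real.le_tan hv0.le hvmem.2
    rwa [hvdef, Real.tan_arctan] at this
  have hs1 : 1 ≤ Real.sqrt (1 + x ^ 2) := Real.one_le_sqrt.mpr (by nlinarith)
  have hL0 : 0 ≤ L := Real.log_nonneg hs1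
  have hLx : L ≤ x ^ 2 := by
    have h1 : L ≤ Real.sqrt (1 + x ^ 2) - 1 := Real.log_le_sub_one_of_pos (by linarith)
    have h2 : Real.sqrt (1 + x ^ 2) ≤ 1 + x ^ 2 := Real.sqrt_le_iff.mpr ⟨by positivity, by nlinarith [sq_nonneg x]⟩
    linarith
  -- From log u ≤ u - 1 at u = (1 + x)/R: the growth rate in x is 1 whatever R is, and R affects
  -- only the constant.
  have hRL : R * L ≤ x + (1 - R + R * Real.log R) := by
    have h1 : L ≤ Real.log (1 + x) := by
      refine Real.log_le_log (by linarith) ?_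
      exact Real.sqrt_le_iff.mpr ⟨by linarith, by nlinarith⟩
    have h2 : Real.log ((1 + x) / R) ≤ (1 + x) / R - 1 :=
      Real.log_le_sub_one_of_pos (by positivity)
    rw [Real.log_div (by linarith) hR.ne'] at h2
    have h3 : R * (Real.log (1 + x) - Real.log R) ≤ R * ((1 + x) / R - 1) :=
      mul_le_mul_of_nonneg_left h2 hR.le
    have h4 : R * ((1 + x) / R - 1) = 1 + x - R := by field_simp
    nlinarith [mul_le_mul_of_nonneg_left h1 hR.le]
  have key := cpow_add_cpow_tan hvmem w
  rw [hvdef, Real.tan_arctan, neg_log_cos_arctan, ← hvdef, ← hL] at key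
  have hwL : ‖w * (L : ℂ)‖ ≤ R * L := by
    rw [norm_mul, Complex.norm_real, Real.norm_of_nonneg hL0]
    exact mul_le_mul_of_nonneg_right hw hL0
  have hwv : ‖w * (v : ℂ)‖ ≤ R * v := by
    rw [norm_mul, Complex.norm_real, Real.norm_of_nonneg hv0.le]
    exact mul_le_mul_of_nonneg_right hw hv0.le
  have hE : Real.exp ‖w * (L : ℂ)‖ ≤
      Real.exp x * Real.exp (1 - R + R * Real.log R) := by
    rw [← Real.exp_add]
    exact Real.exp_le_exp.mpr (hwL.trans hRL)
  have e1 : ‖Complex.exp (w * (L : ℂ))‖ ≤ Real.exp x * Real.exp (1 - R + R * Real.log R) :=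
    (Complex.norm_exp_le_exp_norm _).trans hE
  have e2 : ‖Complex.cos (w * (v : ℂ)) - 1‖ ≤ R ^ 2 * x ^ 2 * Real.exp (R * (Real.pi / 2)) := by
    refine (norm_cos_sub_one_le_mul_exp _).trans ?_
    rw [← mul_pow]
    gcongr
    · exact hwv.trans (by gcongr)
    · exact hwv.trans (by gcongr; exact hvmem.2.le)
  have e3 : ‖Complex.exp (w * (L : ℂ)) - 1‖ ≤
      R * x ^ 2 * (Real.exp x * Real.exp (1 - R + R * Real.log R)) := by
    refine (norm_exp_sub_one_le_mul_exp _).trans ?_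
    gcongr
    exact hwL.trans (by gcongr)
  -- Each summand carries a factor O(x²): cos(wv) - 1 because v ≤ x, and e^(wL) - 1 because L ≤ x².
  have hsplit : -2 + (1 + Complex.I * (x : ℂ)) ^ w + (1 - Complex.I * (x : ℂ)) ^ w =
      2 * (Complex.exp (w * (L : ℂ)) * (Complex.cos (w * (v : ℂ)) - 1) +
        (Complex.exp (w * (L : ℂ)) - 1)) := by
    linear_combination key
  rw [hsplit, norm_mul, Complex.norm_ofNat]
  have e4 : ‖Complex.exp (w * (L : ℂ)) * (Complex.cos (w * (v : ℂ)) - 1)‖ ≤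
      Real.exp x * Real.exp (1 - R + R * Real.log R) *
        (R ^ 2 * x ^ 2 * Real.exp (R * (Real.pi / 2))) := by
    rw [norm_mul]
    gcongr
  have e5 := norm_add_le (Complex.exp (w * (L : ℂ)) * (Complex.cos (w * (v : ℂ)) - 1))
    (Complex.exp (w * (L : ℂ)) - 1)
  calc _ ≤ 2 * (Real.exp x * Real.exp (1 - R + R * Real.log R) *
        (R ^ 2 * x ^ 2 * Real.exp (R * (Real.pi / 2))) +
          R * x ^ 2 * (Real.exp x * Real.exp (1 - R + R * Real.log R))) := by linarith
    _ = _ := by ring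

/-! ### The weight, absolute convergence and holomorphy in k -/

/-- The real weight `e^(-2 π n x) / (1 - e^(-2 π n x))²` of the exponential integrand. -/
noncomputable def expWeight (n : ℕ) (x : ℝ) : ℝ :=
  Real.exp (-2 * Real.pi * n * x) / (1 - Real.exp (-2 * Real.pi * n * x)) ^ 2

theorem expWeight_nonneg (n : ℕ) (x : ℝ) : 0 ≤ expWeight n x := by
  unfold expWeight; positivity

theorem exp_neg_two_pi_mul_lt_one {n : ℕ} (hn : 0 < n) {x : ℝ} (hx : 0 < x) :
    Real.exp (-2 * Real.pi * n * x) < 1 := by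
  have hn' : (0 : ℝ) < n := by exact_mod_cast hn
  have : 0 < 2 * Real.pi * n * x := by positivity
  exact Real.exp_lt_one_iff.mpr (by linarith)

theorem continuousOn_expWeight {n : ℕ} (hn : 0 < n) : ContinuousOn (expWeight n) (Ioi 0) := by
  unfold expWeight
  refine ContinuousOn.div (by fun_prop) (by fun_prop) fun x hx ↦ ?_
  have := exp_neg_two_pi_mul_lt_one hn hx
  exact pow_ne_zero _ (by linarith)

/-- The factor x² cancels the double pole of the weight at 0. The rate 3 leaves room for the factor
e^x in the bound on the numerator. -/
theorem sq_mul_expWeight_le {n : ℕ} (hn : 0 < n) {x : ℝ} (hx : 0 < x) :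
    x ^ 2 * expWeight n x ≤ 16 * Real.exp (-3 * x) := by
  have hn' : (1 : ℝ) ≤ n := by exact_mod_cast hn
  have hq := exp_neg_two_pi_mul_lt_one hn hx
  obtain ⟨y, hy⟩ : ∃ y, y = 2 * Real.pi * n * x := ⟨_, rfl⟩
  have hpn : 3 ≤ Real.pi * n := by nlinarith [Real.pi_gt_three]
  have hxy : 6 * x ≤ y := by rw [hy]; nlinarith
  have hexp : -2 * Real.pi * n * x = -y := by rw [hy]; ring
  unfold expWeight
  rw [hexp] at hq ⊢
  have hy0 : 0 < y := by linarith
  -- This is 1 + y ≤ e^y multiplied by e^(-y). Bounding 1 + y by 4e^(y/4) and squaring costs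
  -- e^(y/2); the remaining e^(-y/2) is at most e^(-3x) since y ≥ 6x.
  have h1 : y ≤ (1 + y) * (1 - Real.exp (-y)) := by
    have h := Real.add_one_le_exp y
    have h' : Real.exp (-y) * Real.exp y = 1 := by rw [← Real.exp_add]; simp
    nlinarith [Real.exp_pos (-y)]
  have h2 : 1 + y ≤ 4 * Real.exp (y / 4) := by linarith [Real.add_one_le_exp (y / 4)]
  have h3 : x ≤ 4 * Real.exp (y / 4) * (1 - Real.exp (-y)) :=
    (by linarith : x ≤ y).trans (h1.trans (mul_le_mul_of_nonneg_right h2 (by linarith)))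
  have h4 : x ^ 2 ≤ 16 * Real.exp (y / 2) * (1 - Real.exp (-y)) ^ 2 := by
    have h := pow_le_pow_left₀ hx.le h3 2
    have h' : Real.exp (y / 2) = Real.exp (y / 4) ^ 2 := by rw [← Real.exp_nat_mul]; ring_nf
    rw [h']
    linarith [h, mul_pow (4 * Real.exp (y / 4)) (1 - Real.exp (-y)) 2,
      mul_pow 4 (Real.exp (y / 4)) 2]
  have hp : 0 < (1 - Real.exp (-y)) ^ 2 := by
    have : 0 < 1 - Real.exp (-y) := by linarith
    positivity
  rw [← mul_div_assoc, div_le_iff₀ hp]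
  calc x ^ 2 * Real.exp (-y)
      ≤ 16 * Real.exp (y / 2) * (1 - Real.exp (-y)) ^ 2 * Real.exp (-y) := by gcongr
    _ = 16 * Real.exp (-(y / 2)) * (1 - Real.exp (-y)) ^ 2 := by
      rw [show -(y / 2) = y / 2 + -y by ring, Real.exp_add]; ring
    _ ≤ _ := by gcongr; linarith

theorem integrableOn_sq_mul_expWeight {n : ℕ} (hn : 0 < n) :
    IntegrableOn (fun x ↦ x ^ 2 * expWeight n x) (Ioi 0) := by
  have hb : IntegrableOn (fun x : ℝ ↦ 16 * Real.exp (-3 * x)) (Ioi 0) :=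
    (integrableOn_exp_mul_Ioi (by norm_num) 0).const_mul 16
  refine Integrable.mono' hb ?_ ?_
  · exact (ContinuousOn.mul (by fun_prop) (continuousOn_expWeight hn)).aestronglyMeasurable
      measurableSet_Ioi
  · refine (ae_restrict_iff' measurableSet_Ioi).mpr (ae_of_all _ fun x hx ↦ ?_)
    rw [Real.norm_of_nonneg (mul_nonneg (sq_nonneg _) (expWeight_nonneg _ _))]
    exact sq_mul_expWeight_le hn hx

theorem expIntegrand_eq (n : ℕ) (k : ℂ) (x : ℝ) :
    expIntegrand n k x =
      (-2 + (1 + Complex.I * (x : ℂ)) ^ (k + 1) + (1 - Complex.I * (x : ℂ)) ^ (k + 1)) *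
        (expWeight n x : ℂ) := rfl

/-- Uniformity over a disc of exponents lets one majorant serve both absolute convergence and
holomorphy in `k`. -/
theorem exists_norm_expIntegrand_le {n : ℕ} (hn : 0 < n) {R : ℝ} (hR : 0 < R) :
    ∃ K : ℝ, ∀ k : ℂ, ‖k + 1‖ ≤ R → ∀ x : ℝ, 0 < x →
      ‖expIntegrand n k x‖ ≤ K * Real.exp (-2 * x) := by
  obtain ⟨K, hK0, hK⟩ := exists_norm_cpow_add_cpow_sub_two_le hR
  refine ⟨K * 16, fun k hk x hx ↦ ?_⟩
  rw [expIntegrand_eq, norm_mul, Complex.norm_real, Real.norm_of_nonneg (expWeight_nonneg _ _)]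
  calc _ ≤ K * (x ^ 2 * Real.exp x) * expWeight n x :=
        mul_le_mul_of_nonneg_right (hK _ hk x hx) (expWeight_nonneg _ _)
    _ = K * Real.exp x * (x ^ 2 * expWeight n x) := by ring
    _ ≤ K * Real.exp x * (16 * Real.exp (-3 * x)) := by
      exact mul_le_mul_of_nonneg_left (sq_mul_expWeight_le hn hx) (by positivity)
    _ = K * 16 * Real.exp (-2 * x) := by
      rw [show -2 * x = x + -3 * x by ring, Real.exp_add]; ring

theorem continuousOn_expIntegrand {n : ℕ} (hn : 0 < n) (k : ℂ) :
    ContinuousOn (expIntegrand n k) (Ioi 0) := by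
  have h1 : Continuous fun x : ℝ ↦ (1 + Complex.I * (x : ℂ)) ^ (k + 1) :=
    Continuous.cpow (by fun_prop) continuous_const fun x ↦ Or.inl (by simp)
  have h2 : Continuous fun x : ℝ ↦ (1 - Complex.I * (x : ℂ)) ^ (k + 1) :=
    Continuous.cpow (by fun_prop) continuous_const fun x ↦ Or.inl (by simp)
  have h3 : ContinuousOn (fun x ↦ ((expWeight n x : ℝ) : ℂ)) (Ioi 0) :=
    Complex.continuous_ofReal.comp_continuousOn (continuousOn_expWeight hn)
  exact ((continuous_const.add h1).add h2).continuousOn.mul h3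

theorem aestronglyMeasurable_expIntegrand {n : ℕ} (hn : 0 < n) (k : ℂ) :
    AEStronglyMeasurable (expIntegrand n k) (volume.restrict (Ioi 0)) :=
  (continuousOn_expIntegrand hn k).aestronglyMeasurable measurableSet_Ioi

theorem integrableOn_expIntegrand {n : ℕ} (hn : 0 < n) (k : ℂ) :
    IntegrableOn (expIntegrand n k) (Ioi 0) := by
  obtain ⟨K, hK⟩ := exists_norm_expIntegrand_le hn (R := ‖k + 1‖ + 1) (by positivity)
  refine Integrable.mono' ((integrableOn_exp_mul_Ioi (a := -2) (by norm_num) 0).const_mul K)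
    (aestronglyMeasurable_expIntegrand hn k) ?_
  exact (ae_restrict_iff' measurableSet_Ioi).mpr
    (ae_of_all _ fun x hx ↦ hK k (by linarith) x hx)

theorem differentiable_integral_expIntegrand {n : ℕ} (hn : 0 < n) :
    Differentiable ℂ fun k ↦ ∫ x in Ioi (0 : ℝ), expIntegrand n k x := by
  intro k
  obtain ⟨K, hK⟩ := exists_norm_expIntegrand_le hn (R := ‖k + 1‖ + 1) (by positivity)
  refine differentiableAt_integral_of_dominated one_pos
    (bound := fun x ↦ K * Real.exp (-2 * x))
    (fun w _ ↦ aestronglyMeasurable_expIntegrand hn w) (ae_of_all _ fun x ↦ ?_) ?_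
    ((integrableOn_exp_mul_Ioi (a := -2) (by norm_num) 0).const_mul K)
  · have h1 : Differentiable ℂ fun w : ℂ ↦ (1 + Complex.I * (x : ℂ)) ^ (w + 1) :=
      (differentiable_id.add_const 1).const_cpow (Or.inl (one_add_I_mul_ne_zero x))
    have h2 : Differentiable ℂ fun w : ℂ ↦ (1 - Complex.I * (x : ℂ)) ^ (w + 1) :=
      (differentiable_id.add_const 1).const_cpow (Or.inl (one_sub_I_mul_ne_zero x))
    exact ((((differentiable_const _).add h1).add h2).mul_const _).differentiableOn
  · refine (ae_restrict_iff' measurableSet_Ioi).mpr (ae_of_all _ fun x hx w hw ↦ hK w ?_ x hx)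
    rw [Metric.mem_ball, dist_eq_norm] at hw
    calc ‖w + 1‖ = ‖(k + 1) + (w - k)‖ := by ring_nf
      _ ≤ ‖k + 1‖ + ‖w - k‖ := norm_add_le _ _
      _ ≤ _ := by linarith

/-! ### Passage between the two integrals -/

/-- The substitution `x = tan v` relates the two integrands. -/
theorem deriv_tan_smul_expIntegrand (n : ℕ) (hn : 0 < n) (k : ℂ) {v : ℝ}
    (hv : v ∈ Ioo 0 (Real.pi / 2)) :
    |1 / Real.cos v ^ 2| • expIntegrand n k (Real.tan v) = -(1 / 2) * trigIntegrand n k v := by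
  have hv' : v ∈ Ioo (-(Real.pi / 2)) (Real.pi / 2) := ⟨by linarith [hv.1, Real.pi_pos], hv.2⟩
  have hc : 0 < Real.cos v := Real.cos_pos_of_mem_Ioo hv'
  have hx : 0 < Real.tan v := Real.tan_pos_of_pos_of_lt_pi_div_two hv.1 hv.2
  have hn' : (0 : ℝ) < n := by exact_mod_cast hn
  have key := cpow_add_cpow_tan hv' (k + 1)
  have hpow : (((Real.cos v : ℝ) : ℂ) ^ (k + 1))⁻¹ =
      Complex.exp ((k + 1) * ((-Real.log (Real.cos v) : ℝ) : ℂ)) := by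
    rw [Complex.cpow_def_of_ne_zero (by exact_mod_cast hc.ne'), ← Complex.exp_neg,
      ← Complex.ofReal_log hc.le]
    push_cast
    ring_nf
  -- With y = πn tan v: csch² y = 4e^(-2y)/(1 - e^(-2y))², while sec² v is the derivative of tan.
  have hw : (sec v * csch (Real.pi * n * Real.tan v)) ^ 2 =
      4 * (1 / Real.cos v ^ 2 * expWeight n (Real.tan v)) := by
    obtain ⟨y, hy⟩ : ∃ y, y = Real.pi * n * Real.tan v := ⟨_, rfl⟩
    have hy0 : 0 < y := by rw [hy]; positivity
    have he : -2 * Real.pi * n * Real.tan v = -y + -y := by rw [hy]; ring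
    have hlt : Real.exp (-y) < 1 := Real.exp_lt_one_iff.mpr (by linarith)
    have hp := Real.exp_pos (-y)
    unfold sec csch expWeight
    rw [he, ← hy, Real.sinh_eq, Real.exp_add, show Real.exp y = (Real.exp (-y))⁻¹ by
      rw [Real.exp_neg, inv_inv]]
    have h1 : 1 - Real.exp (-y) * Real.exp (-y) ≠ 0 := by nlinarith
    have h2 : (Real.exp (-y))⁻¹ - Real.exp (-y) =
        (1 - Real.exp (-y) * Real.exp (-y)) / (Real.exp (-y)) := by field_simp
    rw [h2]
    field_simp
    norm_num
  rw [abs_of_pos (by positivity), Complex.real_smul, expIntegrand_eq, trigIntegrand, hw,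
    div_eq_mul_inv (Complex.cos _), hpow]
  push_cast at key ⊢
  linear_combination (1 / Complex.cos v ^ 2 * (expWeight n (Real.tan v) : ℂ)) * key

theorem image_tan_Ioo : Real.tan '' Ioo 0 (Real.pi / 2) = Ioi 0 := by
  ext x
  constructor
  · rintro ⟨v, hv, rfl⟩
    exact Real.tan_pos_of_pos_of_lt_pi_div_two hv.1 hv.2
  · intro hx
    exact ⟨Real.arctan x, ⟨Real.arctan_pos.mpr hx, Real.arctan_lt_pi_div_two x⟩,
      Real.tan_arctan x⟩

theorem tan_hasDerivWithinAt {v : ℝ} (hv : v ∈ Ioo 0 (Real.pi / 2)) :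
    HasDerivWithinAt Real.tan (1 / Real.cos v ^ 2) (Ioo 0 (Real.pi / 2)) v :=
  (Real.hasDerivAt_tan_of_mem_Ioo
    ⟨by linarith [hv.1, Real.pi_pos], hv.2⟩).hasDerivWithinAt

theorem injOn_tan_Ioo : InjOn Real.tan (Ioo 0 (Real.pi / 2)) :=
  Real.injOn_tan.mono (Ioo_subset_Ioo_left (by linarith [Real.pi_pos]))

theorem intervalIntegrable_trigIntegrand {n : ℕ} (hn : 0 < n) (k : ℂ) :
    IntervalIntegrable (trigIntegrand n k) volume 0 (Real.pi / 2) := by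
  have h := (integrableOn_image_iff_integrableOn_abs_deriv_smul measurableSet_Ioo
    (fun v hv ↦ tan_hasDerivWithinAt hv) injOn_tan_Ioo (expIntegrand n k)).mp
    (by rw [image_tan_Ioo]; exact integrableOn_expIntegrand hn k)
  have h2 : IntegrableOn (fun v ↦ -2 * (-(1 / 2) * trigIntegrand n k v)) (Ioo 0 (Real.pi / 2)) :=
    (h.congr_fun (fun v hv ↦ deriv_tan_smul_expIntegrand n hn k hv)
      measurableSet_Ioo).const_mul (-2)
  rw [intervalIntegrable_iff_integrableOn_Ioo_of_le (by positivity)]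
  refine h2.congr_fun (fun v _ ↦ ?_) measurableSet_Ioo
  ring

theorem integral_trigIntegrand {n : ℕ} (hn : 0 < n) (k : ℂ) :
    ∫ v in (0 : ℝ)..(Real.pi / 2), trigIntegrand n k v =
      -2 * ∫ x in Ioi (0 : ℝ), expIntegrand n k x := by
  rw [← image_tan_Ioo, integral_image_eq_integral_abs_deriv_smul measurableSet_Ioo
    (fun v hv ↦ tan_hasDerivWithinAt hv) injOn_tan_Ioo,
    setIntegral_congr_fun measurableSet_Ioo
      (fun v hv ↦ deriv_tan_smul_expIntegrand n hn k hv),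
    integral_const_mul, intervalIntegral.integral_of_le (by positivity), integral_Ioc_eq_integral_Ioo]
  ring

/-! ### Gamma integrals with complex scale -/

theorem integrableOn_rpow_mul_exp_neg_mul {s b : ℝ} (hs : -1 < s) (hb : 0 < b) :
    IntegrableOn (fun t : ℝ ↦ t ^ s * Real.exp (-(b * t))) (Ioi 0) := by
  simpa using integrableOn_rpow_mul_exp_neg_mul_rpow hs one_pos hb

theorem norm_cpow_mul_exp_neg_mul (a r : ℂ) {t : ℝ} (ht : 0 < t) :
    ‖(t : ℂ) ^ a * Complex.exp (-(r * t))‖ = t ^ a.re * Real.exp (-(r.re * t)) := by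
  rw [norm_mul, Complex.norm_cpow_eq_rpow_re_of_pos ht, Complex.norm_exp]
  simp

theorem continuousOn_ofReal_cpow (a : ℂ) : ContinuousOn (fun t : ℝ ↦ (t : ℂ) ^ a) (Ioi 0) :=
  ContinuousOn.cpow (by fun_prop) continuousOn_const fun t ht ↦ Or.inl (by simpa using ht)

theorem continuousOn_cpow_mul_exp_neg_mul (a r : ℂ) :
    ContinuousOn (fun t : ℝ ↦ (t : ℂ) ^ a * Complex.exp (-(r * t))) (Ioi 0) :=
  (continuousOn_ofReal_cpow a).mul (by fun_prop)

theorem integrableOn_cpow_mul_exp_neg_mul {a r : ℂ} (ha : -1 < a.re) (hr : 0 < r.re) :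
    IntegrableOn (fun t : ℝ ↦ (t : ℂ) ^ a * Complex.exp (-(r * t))) (Ioi 0) := by
  refine Integrable.mono' (integrableOn_rpow_mul_exp_neg_mul ha hr)
    ((continuousOn_cpow_mul_exp_neg_mul a r).aestronglyMeasurable measurableSet_Ioi) ?_
  exact (ae_restrict_iff' measurableSet_Ioi).mpr
    (ae_of_all _ fun t ht ↦ (norm_cpow_mul_exp_neg_mul a r ht).le)

/-- The Gamma integral with a complex scale in the right half plane. -/
theorem integral_cpow_mul_exp_neg_mul_of_re_pos {a r : ℂ} (ha : 0 < a.re) (hr : 0 < r.re) :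
    ∫ t in Ioi (0 : ℝ), (t : ℂ) ^ (a - 1) * Complex.exp (-(r * t)) =
      r ^ (-a) * Complex.Gamma a := by
  have hopen : IsOpen {z : ℂ | 0 < z.re} := isOpen_lt continuous_const Complex.continuous_re
  have hre : -1 < (a - 1).re := by simpa using ha
  have hf : AnalyticOnNhd ℂ
      (fun r : ℂ ↦ ∫ t in Ioi (0 : ℝ), (t : ℂ) ^ (a - 1) * Complex.exp (-(r * t)))
      {z : ℂ | 0 < z.re} := by
    refine DifferentiableOn.analyticOnNhd (fun z hz ↦ ?_) hopen
    have hz' : 0 < z.re := hz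
    refine (differentiableAt_integral_of_dominated (half_pos hz')
      (bound := fun t ↦ t ^ (a - 1).re * Real.exp (-(z.re / 2 * t))) (fun w _ ↦ ?_)
      (ae_of_all _ fun t ↦ ?_) ?_ ?_).differentiableWithinAt
    · exact (continuousOn_cpow_mul_exp_neg_mul _ w).aestronglyMeasurable measurableSet_Ioi
    · exact Differentiable.differentiableOn (by fun_prop)
    · refine (ae_restrict_iff' measurableSet_Ioi).mpr (ae_of_all _ fun t ht w hw ↦ ?_)
      have ht' : 0 < t := ht
      rw [norm_cpow_mul_exp_neg_mul _ _ ht']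
      have h1 : z.re / 2 ≤ w.re := by
        rw [Metric.mem_ball, dist_comm, dist_eq_norm] at hw
        have := (Complex.re_le_norm (z - w)).trans hw.le
        rw [Complex.sub_re] at this
        linarith
      have h2 : z.re / 2 * t ≤ w.re * t := mul_le_mul_of_nonneg_right h1 ht'.le
      gcongr
    · exact integrableOn_rpow_mul_exp_neg_mul hre (half_pos hz')
  have hg : AnalyticOnNhd ℂ (fun r : ℂ ↦ r ^ (-a) * Complex.Gamma a) {z : ℂ | 0 < z.re} := by
    refine DifferentiableOn.analyticOnNhd (fun z hz ↦ ?_) hopen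
    exact ((differentiableAt_id.cpow_const (Or.inl hz)).mul_const _).differentiableWithinAt
  have hconn : IsPreconnected {z : ℂ | 0 < z.re} := (convex_halfSpace_re_gt 0).isPreconnected
  -- Both sides are analytic in `r`; the formula for real scales, which accumulate at 1 from the
  -- right, forces equality on the half plane.
  refine hf.eqOn_of_preconnected_of_frequently_eq hg hconn (z₀ := 1) (by simp) ?_ hr
  have ht : Tendsto (fun x : ℝ ↦ (x : ℂ)) (𝓝[>] 1) (𝓝[≠] 1) := by
    refine tendsto_nhdsWithin_iff.mpr ⟨?_, ?_⟩
    · have h := (Complex.continuous_ofReal.tendsto 1).mono_left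
        (nhdsWithin_le_nhds (s := Ioi (1 : ℝ)))
      rwa [Complex.ofReal_one] at h
    · filter_upwards [self_mem_nhdsWithin] with x hx
      have : x ≠ 1 := ne_of_gt hx
      simpa using this
  refine ht.frequently (Eventually.frequently ?_)
  filter_upwards [self_mem_nhdsWithin] with x hx
  have hx0 : 0 < x := one_pos.trans hx
  rw [Complex.integral_cpow_mul_exp_neg_mul_Ioi ha hx0, one_div, Complex.inv_cpow, Complex.cpow_neg]
  rw [Complex.arg_ofReal_of_nonneg hx0.le]
  exact Real.pi_pos.ne

/-! ### Partial fractions and the cosine transform of the weight -/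

/-- The partial fraction series of π cot(πx) at x = it/(2π), a point off the real axis where
e^(2πix) = e^(-t). -/
theorem tsum_two_mul_div_sq_add_sq {t : ℝ} (ht : 0 < t) :
    ∑' m : ℕ, 2 * t / (t ^ 2 + 4 * Real.pi ^ 2 * ((m : ℝ) + 1) ^ 2) =
      1 / (1 - Real.exp (-t)) - 1 / t - 1 / 2 := by
  have hpi := Real.pi_pos
  have hpiC : (Real.pi : ℂ) ≠ 0 := by exact_mod_cast hpi.ne'
  have htC : (t : ℂ) ≠ 0 := by exact_mod_cast ht.ne'
  have hlt : Real.exp (-t) < 1 := Real.exp_lt_one_iff.mpr (by linarith)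
  have hltC : 1 - Complex.exp (-(t : ℂ)) ≠ 0 := by
    have : (1 - Real.exp (-t) : ℝ) ≠ 0 := by linarith
    exact_mod_cast this
  set x : ℂ := Complex.I * t / (2 * Real.pi) with hx
  have him : x.im = t / (2 * Real.pi) := by
    have : x = ((t / (2 * Real.pi) : ℝ) : ℂ) * Complex.I := by rw [hx]; push_cast; ring
    rw [this, Complex.im_ofReal_mul, Complex.I_im, mul_one]
  have hmem : x ∈ Complex.integerComplement :=
    UpperHalfPlane.coe_mem_integerComplement ⟨x, by rw [him]; positivity⟩
  have key := cot_series_rep' hmem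
  have harg : 2 * Complex.I * (Real.pi * x) = -(t : ℂ) := by
    rw [hx]; field_simp; rw [Complex.I_sq]
  rw [Complex.cot_eq_exp_ratio, harg] at key
  have hterm : ∀ m : ℕ, ((2 * t / (t ^ 2 + 4 * Real.pi ^ 2 * ((m : ℝ) + 1) ^ 2) : ℝ) : ℂ) =
      Complex.I / (2 * Real.pi) * (1 / (x - ((m : ℂ) + 1)) + 1 / (x + ((m : ℂ) + 1))) := by
    intro m
    have h1 : x - ((m : ℂ) + 1) ≠ 0 := by
      intro h
      have := congrArg Complex.im h
      simp [him] at this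
      exact ht.ne' this
    have h2 : x + ((m : ℂ) + 1) ≠ 0 := by
      intro h
      have := congrArg Complex.im h
      simp [him] at this
      exact ht.ne' this
    have h3 : (t : ℂ) ^ 2 + 4 * Real.pi ^ 2 * ((m : ℂ) + 1) ^ 2 ≠ 0 := by
      have : (t ^ 2 + 4 * Real.pi ^ 2 * ((m : ℝ) + 1) ^ 2 : ℝ) ≠ 0 := by positivity
      exact_mod_cast this
    have h4 : (x - ((m : ℂ) + 1)) * (x + ((m : ℂ) + 1)) =
        -((t : ℂ) ^ 2 + 4 * Real.pi ^ 2 * ((m : ℂ) + 1) ^ 2) / (4 * Real.pi ^ 2) := by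
      rw [hx]; field_simp; ring_nf; rw [Complex.I_sq]; ring
    have h5 : 1 / (x - ((m : ℂ) + 1)) + 1 / (x + ((m : ℂ) + 1)) =
        2 * x / ((x - ((m : ℂ) + 1)) * (x + ((m : ℂ) + 1))) := by
      field_simp; ring
    rw [h5, h4, hx]
    push_cast
    field_simp
    rw [Complex.I_sq]
    ring
  apply Complex.ofReal_injective
  rw [Complex.ofReal_tsum]
  simp_rw [hterm]
  rw [tsum_mul_left, ← key, hx]
  push_cast
  field_simp
  ring_nf

theorem integrableOn_exp_mul_one_sub_cos (a : ℝ) {b : ℝ} (hb : 0 < b) :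
    IntegrableOn (fun x : ℝ ↦ (2 - 2 * Real.cos (a * x)) * Real.exp (-b * x)) (Ioi 0) := by
  refine Integrable.mono' ((integrableOn_exp_mul_Ioi (a := -b) (by linarith) 0).const_mul 4)
    (Continuous.aestronglyMeasurable (by fun_prop)) (ae_of_all _ fun x ↦ ?_)
  rw [norm_mul, Real.norm_of_nonneg (Real.exp_pos _).le]
  refine mul_le_mul_of_nonneg_right ?_ (Real.exp_pos _).le
  rw [Real.norm_eq_abs, abs_le]
  constructor <;> linarith [Real.neg_one_le_cos (a * x), Real.cos_le_one (a * x)]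

theorem integral_exp_mul_one_sub_cos (a : ℝ) {b : ℝ} (hb : 0 < b) :
    ∫ x in Ioi (0 : ℝ), (2 - 2 * Real.cos (a * x)) * Real.exp (-b * x) =
      2 * a ^ 2 / (b * (a ^ 2 + b ^ 2)) := by
  apply Complex.ofReal_injective
  rw [← integral_complex_ofReal]
  have h0 : (-(b : ℂ)).re < 0 := by simpa using hb
  have h1 : (-(b : ℂ) + a * Complex.I).re < 0 := by simpa using hb
  have h2 : (-(b : ℂ) - a * Complex.I).re < 0 := by simpa using hb
  have hsplit : ∀ x : ℝ, (((2 - 2 * Real.cos (a * x)) * Real.exp (-b * x) : ℝ) : ℂ) =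
      2 * Complex.exp (-(b : ℂ) * x) - Complex.exp ((-(b : ℂ) + a * Complex.I) * x) -
        Complex.exp ((-(b : ℂ) - a * Complex.I) * x) := by
    intro x
    push_cast
    rw [show (-(b : ℂ) + a * Complex.I) * x = -(b : ℂ) * x + a * x * Complex.I by ring,
      show (-(b : ℂ) - a * Complex.I) * x = -(b : ℂ) * x + -(a * x) * Complex.I by ring,
      Complex.exp_add, Complex.exp_add, Complex.cos]
    ring
  simp_rw [hsplit]
  have i0 := (integrableOn_exp_mul_complex_Ioi h0 0).const_mul 2
  have i1 := integrableOn_exp_mul_complex_Ioi h1 0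
  have i2 := integrableOn_exp_mul_complex_Ioi h2 0
  have i01 : Integrable (fun x : ℝ ↦ 2 * Complex.exp (-(b : ℂ) * x) -
      Complex.exp ((-(b : ℂ) + a * Complex.I) * x)) (volume.restrict (Ioi 0)) := i0.sub i1
  rw [integral_sub i01 i2, integral_sub i0 i1, integral_const_mul,
    integral_exp_mul_complex_Ioi h0, integral_exp_mul_complex_Ioi h1,
    integral_exp_mul_complex_Ioi h2]
  have hbC : (b : ℂ) ≠ 0 := by exact_mod_cast hb.ne'
  have n1 : -(b : ℂ) + a * Complex.I ≠ 0 := fun h ↦ by rw [h] at h1; simp at h1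
  have n2 : -(b : ℂ) - a * Complex.I ≠ 0 := fun h ↦ by rw [h] at h2; simp at h2
  have n3 : (a : ℂ) ^ 2 + (b : ℂ) ^ 2 = (-(b : ℂ) + a * Complex.I) * (-(b : ℂ) - a * Complex.I) := by
    linear_combination (a : ℂ) ^ 2 * Complex.I_sq
  push_cast
  rw [n3]
  simp only [mul_zero, Complex.exp_zero]
  field_simp
  linear_combination (-2 * (a : ℂ) ^ 2) * Complex.I_sq

/-- The series Σ m q^m = q/(1 - q)² at q = e^(-2πnx), with its vanishing term m = 0 dropped. -/
theorem hasSum_expWeight {n : ℕ} (hn : 0 < n) {x : ℝ} (hx : 0 < x) :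
    HasSum (fun m : ℕ ↦ ((m : ℝ) + 1) * Real.exp (-(2 * Real.pi * n * ((m : ℝ) + 1)) * x))
      (expWeight n x) := by
  have hlt := exp_neg_two_pi_mul_lt_one hn hx
  have h := hasSum_coe_mul_geometric_of_norm_lt_one (𝕜 := ℝ)
    (r := Real.exp (-2 * Real.pi * n * x)) (by rwa [Real.norm_of_nonneg (Real.exp_pos _).le])
  have h2 := (hasSum_nat_add_iff' 1).mpr h
  simp only [Finset.range_one, Finset.sum_singleton, Nat.cast_zero, zero_mul, sub_zero] at h2
  have heq : (fun m : ℕ ↦ ((m : ℝ) + 1) * Real.exp (-(2 * Real.pi * n * ((m : ℝ) + 1)) * x)) =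
      fun m : ℕ ↦ ((m + 1 : ℕ) : ℝ) * Real.exp (-2 * Real.pi * n * x) ^ (m + 1) := by
    funext m
    rw [← Real.exp_nat_mul]
    push_cast
    ring_nf
  rw [heq]
  exact h2

/-- The cosine transform of the weight. -/
theorem integral_one_sub_cos_mul_expWeight {n : ℕ} (hn : 0 < n) {t : ℝ} (ht : 0 < t) :
    ∫ x in Ioi (0 : ℝ), (2 - 2 * Real.cos (n * t * x)) * expWeight n x =
      t / (2 * Real.pi * n) * (1 / (1 - Real.exp (-t)) - 1 / t - 1 / 2) := by
  have hn' : (0 : ℝ) < n := by exact_mod_cast hn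
  have hpi := Real.pi_pos
  set F : ℕ → ℝ → ℝ := fun m x ↦ ((m : ℝ) + 1) *
    ((2 - 2 * Real.cos (n * t * x)) * Real.exp (-(2 * Real.pi * n * ((m : ℝ) + 1)) * x)) with hF
  have hb : ∀ m : ℕ, 0 < 2 * Real.pi * n * ((m : ℝ) + 1) := fun m ↦ by positivity
  have hFint : ∀ m, Integrable (F m) (volume.restrict (Ioi 0)) := fun m ↦
    (integrableOn_exp_mul_one_sub_cos (n * t) (hb m)).const_mul _
  have hFval : ∀ m, ∫ x in Ioi (0 : ℝ), F m x =
      t / (2 * Real.pi * n) * (2 * t / (t ^ 2 + 4 * Real.pi ^ 2 * ((m : ℝ) + 1) ^ 2)) := by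
    intro m
    simp only [hF]
    rw [integral_const_mul, integral_exp_mul_one_sub_cos _ (hb m)]
    have h1 : ((n : ℝ) * t) ^ 2 + (2 * Real.pi * n * ((m : ℝ) + 1)) ^ 2 =
      n ^ 2 * (t ^ 2 + 4 * Real.pi ^ 2 * ((m : ℝ) + 1) ^ 2) := by ring
    rw [h1]
    field_simp
  have hFnonneg : ∀ m x, 0 ≤ F m x := fun m x ↦ by
    have := Real.cos_le_one (n * t * x)
    have : 0 ≤ 2 - 2 * Real.cos (n * t * x) := by linarith
    simp only [hF]; positivity
  -- The terms are nonnegative, so their norms integrate to the values just computed, which are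
  -- O(1/(m+1)²); this justifies termwise integration.
  have hsummable : Summable fun m ↦ ∫ x in Ioi (0 : ℝ), ‖F m x‖ := by
    simp_rw [Real.norm_of_nonneg (hFnonneg _ _), hFval]
    refine Summable.mul_left _ ?_
    have hs : Summable fun m : ℕ ↦ 2 * t / (4 * Real.pi ^ 2) * (1 / ((m + 1 : ℕ) : ℝ) ^ 2) :=
      ((summable_nat_add_iff 1).mpr (Real.summable_one_div_nat_pow.mpr one_lt_two)).mul_left _
    refine Summable.of_nonneg_of_le (fun m ↦ by positivity) (fun m ↦ ?_) hs
    rw [div_mul_div_comm, mul_one]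
    push_cast
    gcongr
    nlinarith
  have h := (hasSum_integral_of_summable_integral_norm hFint hsummable).tsum_eq
  simp_rw [hFval] at h
  rw [tsum_mul_left, tsum_two_mul_div_sq_add_sq ht] at h
  rw [h]
  refine setIntegral_congr_fun measurableSet_Ioi fun x hx ↦ ?_
  have hs := ((hasSum_expWeight hn hx).mul_left (2 - 2 * Real.cos (n * t * x))).tsum_eq
  simp only [hF]
  rw [← hs]
  exact tsum_congr fun m ↦ by ring

/-! ### The double integral and the Mellin transform -/

theorem natCast_mul_cpow {n : ℕ} (hn : 0 < n) {z : ℂ} (hz : z ≠ 0) (w : ℂ) :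
    ((n : ℂ) * z) ^ w = (n : ℂ) ^ w * z ^ w := by
  have hn' : (0 : ℝ) < n := by exact_mod_cast hn
  have hnC : (n : ℂ) ≠ 0 := by exact_mod_cast hn.ne'
  have h := Complex.log_ofReal_mul hn' hz
  rw [Complex.ofReal_natCast, Complex.ofReal_log hn'.le, Complex.ofReal_natCast] at h
  rw [Complex.cpow_def_of_ne_zero (mul_ne_zero hnC hz), h, add_mul, Complex.exp_add,
    ← Complex.cpow_def_of_ne_zero hnC, ← Complex.cpow_def_of_ne_zero hz]

/-- The integrand of the double integral linking the Mellin transform to the exponential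
integral. -/
noncomputable def doubleIntegrand (n : ℕ) (s : ℂ) (t x : ℝ) : ℂ :=
  (t : ℂ) ^ (s - 2) * Complex.exp (-((n : ℂ) * t)) *
    (((2 - 2 * Real.cos (n * t * x)) * expWeight n x : ℝ) : ℂ)

/-- The bound 2 - 2cos u ≤ u² at u = ntx separates the variables, giving a product of two integrable
functions. -/
theorem integrable_doubleIntegrand {n : ℕ} (hn : 0 < n) {s : ℂ} (hs : 1 < s.re) :
    Integrable (Function.uncurry (doubleIntegrand n s))
      ((volume.restrict (Ioi (0 : ℝ))).prod (volume.restrict (Ioi (0 : ℝ)))) := by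
  have hn' : (0 : ℝ) < n := by exact_mod_cast hn
  have hb : Integrable (fun z : ℝ × ℝ ↦
      ((n : ℝ) ^ 2 * (z.1 ^ s.re * Real.exp (-(n * z.1)))) * (z.2 ^ 2 * expWeight n z.2))
      ((volume.restrict (Ioi (0 : ℝ))).prod (volume.restrict (Ioi (0 : ℝ)))) :=
    ((integrableOn_rpow_mul_exp_neg_mul (by linarith) hn').const_mul _).mul_prod
      (integrableOn_sq_mul_expWeight hn)
  rw [Measure.prod_restrict] at hb ⊢
  refine hb.mono' ?_ ?_
  · refine ContinuousOn.aestronglyMeasurable ?_ (measurableSet_Ioi.prod measurableSet_Ioi)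
    have h1 : ContinuousOn (fun z : ℝ × ℝ ↦ (z.1 : ℂ) ^ (s - 2)) (Ioi 0 ×ˢ Ioi 0) :=
      (continuousOn_ofReal_cpow (s - 2)).comp continuousOn_fst fun z hz ↦ hz.1
    have h2 : ContinuousOn (fun z : ℝ × ℝ ↦ expWeight n z.2) (Ioi 0 ×ˢ Ioi 0) :=
      (continuousOn_expWeight hn).comp continuousOn_snd fun z hz ↦ hz.2
    have h3 : ContinuousOn (fun z : ℝ × ℝ ↦
        (((2 - 2 * Real.cos (n * z.1 * z.2)) * expWeight n z.2 : ℝ) : ℂ)) (Ioi 0 ×ˢ Ioi 0) :=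
      Complex.continuous_ofReal.comp_continuousOn (ContinuousOn.mul (by fun_prop) h2)
    exact (h1.mul (by fun_prop)).mul h3
  · refine (ae_restrict_iff' (measurableSet_Ioi.prod measurableSet_Ioi)).mpr
      (ae_of_all _ fun z hz ↦ ?_)
    obtain ⟨t, x⟩ := z
    have ht : 0 < t := hz.1
    have hw := expWeight_nonneg n x
    have hc := Real.cos_le_one (n * t * x)
    have hc' := Real.one_sub_sq_div_two_le_cos (x := n * t * x)
    have hpow : t ^ s.re = t ^ (s - 2).re * t ^ 2 := by
      rw [← Real.rpow_natCast t 2, ← Real.rpow_add ht]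
      congr 1
      simp
    have h0 : 0 ≤ t ^ (s - 2).re * Real.exp (-(n * t)) := by positivity
    simp only [Function.uncurry_apply_pair, doubleIntegrand]
    rw [norm_mul, norm_cpow_mul_exp_neg_mul _ _ ht, Complex.norm_real, Complex.natCast_re,
      Real.norm_of_nonneg (mul_nonneg (by linarith) hw), hpow]
    calc _ ≤ t ^ (s - 2).re * Real.exp (-(n * t)) * ((n * t * x) ^ 2 * expWeight n x) :=
          mul_le_mul_of_nonneg_left (mul_le_mul_of_nonneg_right (by linarith) hw) h0
      _ = _ := by ring

/-- Euler's formula absorbs the cosine into e^(-nt), leaving Gamma integrals with scales n and n(1 ±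
ix). -/
theorem integral_doubleIntegrand_fst {n : ℕ} (hn : 0 < n) {s : ℂ} (hs : 1 < s.re) (x : ℝ) :
    ∫ t in Ioi (0 : ℝ), doubleIntegrand n s t x =
      -(Complex.Gamma (s - 1) * (n : ℂ) ^ (1 - s)) * expIntegrand n (-s) x := by
  have hn' : (0 : ℝ) < n := by exact_mod_cast hn
  have hs1 : 0 < (s - 1).re := by simpa using hs
  have hs2 : -1 < (s - 2).re := by simp; linarith
  have r0 : 0 < (n : ℂ).re := by simpa using hn
  have r1 : 0 < ((n : ℂ) * (1 + Complex.I * x)).re := by simpa using hn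
  have r2 : 0 < ((n : ℂ) * (1 - Complex.I * x)).re := by simpa using hn
  have hsplit : ∀ t : ℝ, doubleIntegrand n s t x =
      (2 * ((t : ℂ) ^ (s - 2) * Complex.exp (-((n : ℂ) * t))) -
        (t : ℂ) ^ (s - 2) * Complex.exp (-((n : ℂ) * (1 + Complex.I * x) * t)) -
        (t : ℂ) ^ (s - 2) * Complex.exp (-((n : ℂ) * (1 - Complex.I * x) * t))) *
          (expWeight n x : ℂ) := by
    intro t
    rw [doubleIntegrand,
      show -((n : ℂ) * (1 + Complex.I * x) * t) = -((n : ℂ) * t) + -(n * t * x) * Complex.I by ring,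
      show -((n : ℂ) * (1 - Complex.I * x) * t) = -((n : ℂ) * t) + n * t * x * Complex.I by ring,
      Complex.exp_add, Complex.exp_add]
    push_cast
    rw [Complex.cos]
    ring
  simp_rw [hsplit]
  have i0 := (integrableOn_cpow_mul_exp_neg_mul hs2 r0).const_mul 2
  have i1 := integrableOn_cpow_mul_exp_neg_mul hs2 r1
  have i2 := integrableOn_cpow_mul_exp_neg_mul hs2 r2
  have i01 : Integrable (fun t : ℝ ↦ 2 * ((t : ℂ) ^ (s - 2) * Complex.exp (-((n : ℂ) * t))) -
      (t : ℂ) ^ (s - 2) * Complex.exp (-((n : ℂ) * (1 + Complex.I * x) * t)))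
      (volume.restrict (Ioi 0)) := i0.sub i1
  have hs3 : s - 2 = s - 1 - 1 := by ring
  rw [integral_mul_const, integral_sub i01 i2, integral_sub i0 i1, integral_const_mul, hs3,
    integral_cpow_mul_exp_neg_mul_of_re_pos hs1 r0,
    integral_cpow_mul_exp_neg_mul_of_re_pos hs1 r1,
    integral_cpow_mul_exp_neg_mul_of_re_pos hs1 r2,
    natCast_mul_cpow hn (one_add_I_mul_ne_zero x), natCast_mul_cpow hn (one_sub_I_mul_ne_zero x),
    expIntegrand_eq, neg_sub, show -s + 1 = 1 - s by ring]
  ring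

theorem integral_doubleIntegrand_snd {n : ℕ} (hn : 0 < n) (s : ℂ) {t : ℝ} (ht : 0 < t) :
    ∫ x in Ioi (0 : ℝ), doubleIntegrand n s t x =
      (t : ℂ) ^ (s - 2) * Complex.exp (-((n : ℂ) * t)) *
        ((t / (2 * Real.pi * n) * (1 / (1 - Real.exp (-t)) - 1 / t - 1 / 2) : ℝ) : ℂ) := by
  simp only [doubleIntegrand]
  rw [integral_const_mul, integral_complex_ofReal, integral_one_sub_cos_mul_expWeight hn ht]

/-- The Mellin transform of the generating function of the tail of the zeta series. -/
theorem mellin_exp_div_one_sub_exp {n : ℕ} (hn : 0 < n) {s : ℂ} (hs : 1 < s.re) :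
    mellin (fun t ↦ Complex.exp (-((n : ℂ) * t)) / (1 - Complex.exp (-(t : ℂ)))) s =
      Complex.Gamma (s - 1) * ((n : ℂ) ^ (1 - s) + (s - 1) * (n : ℂ) ^ (-s) / 2 -
        2 * Real.pi * (n : ℂ) ^ (2 - s) * ∫ x in Ioi (0 : ℝ), expIntegrand n (-s) x) := by
  have hnC : (n : ℂ) ≠ 0 := by exact_mod_cast hn.ne'
  have hpiC : (Real.pi : ℂ) ≠ 0 := by exact_mod_cast Real.pi_pos.ne'
  have hs0 : 0 < s.re := by linarith
  have hs1 : 0 < (s - 1).re := by simpa using hs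
  have r0 : 0 < (n : ℂ).re := by simpa using hn
  have hs3 : s - 2 = s - 1 - 1 := by ring
  have hdouble : ∫ t in Ioi (0 : ℝ), ∫ x in Ioi (0 : ℝ), doubleIntegrand n s t x =
      -(Complex.Gamma (s - 1) * (n : ℂ) ^ (1 - s)) * ∫ x in Ioi (0 : ℝ), expIntegrand n (-s) x := by
    rw [integral_integral_swap (integrable_doubleIntegrand hn hs)]
    simp_rw [integral_doubleIntegrand_fst hn hs]
    rw [integral_const_mul]
  -- The three terms come from 1/(1 - e^(-t)) = 1/t + 1/2 + r(t); the factor 2πn undoes the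
  -- normalisation of the cosine transform.
  have hsplit : ∀ t ∈ Ioi (0 : ℝ), (t : ℂ) ^ (s - 1) •
      (Complex.exp (-((n : ℂ) * t)) / (1 - Complex.exp (-(t : ℂ)))) =
        (t : ℂ) ^ (s - 1 - 1) * Complex.exp (-((n : ℂ) * t)) +
          1 / 2 * ((t : ℂ) ^ (s - 1) * Complex.exp (-((n : ℂ) * t))) +
          2 * Real.pi * n * ∫ x in Ioi (0 : ℝ), doubleIntegrand n s t x := by
    intro t ht
    have htC : (t : ℂ) ≠ 0 := Complex.ofReal_ne_zero.mpr (ne_of_gt ht)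
    rw [integral_doubleIntegrand_snd hn s ht, hs3, Complex.cpow_sub (s - 1) 1 htC,
      Complex.cpow_one, smul_eq_mul]
    push_cast
    field_simp
    ring
  have i0 := integrableOn_cpow_mul_exp_neg_mul (a := s - 1 - 1) (by simpa using hs1) r0
  have i1 := (integrableOn_cpow_mul_exp_neg_mul (a := s - 1) (by simpa using hs0) r0).const_mul
    (1 / 2)
  have i2 := (integrable_doubleIntegrand hn hs).integral_prod_left.const_mul
    (2 * (Real.pi : ℂ) * n)
  simp only [Function.uncurry_apply_pair] at i2
  have i01 : Integrable (fun t : ℝ ↦ (t : ℂ) ^ (s - 1 - 1) * Complex.exp (-((n : ℂ) * t)) +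
      1 / 2 * ((t : ℂ) ^ (s - 1) * Complex.exp (-((n : ℂ) * t)))) (volume.restrict (Ioi 0)) :=
    i0.add i1
  have hGamma : Complex.Gamma s = (s - 1) * Complex.Gamma (s - 1) := by
    have h := Complex.Gamma_add_one (s - 1) (fun h ↦ by rw [h] at hs1; simp at hs1)
    rwa [sub_add_cancel] at h
  have hpow : (n : ℂ) ^ (2 - s) = n * (n : ℂ) ^ (1 - s) := by
    rw [show 2 - s = 1 + (1 - s) by ring, Complex.cpow_add _ _ hnC, Complex.cpow_one]
  rw [mellin, setIntegral_congr_fun measurableSet_Ioi hsplit, integral_add i01 i2,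
    integral_add i0 i1, integral_const_mul, integral_const_mul, hdouble,
    integral_cpow_mul_exp_neg_mul_of_re_pos hs1 r0,
    integral_cpow_mul_exp_neg_mul_of_re_pos hs0 r0, hGamma, neg_sub, hpow]
  ring

/-! ### The zeta tail, the case Re k < -1, and analytic continuation -/

theorem hasSum_zeta_tail {n : ℕ} (hn : 0 < n) {s : ℂ} (hs : 1 < s.re) :
    HasSum (fun i : ℕ ↦ Complex.Gamma s * 1 / (((n : ℝ) + i : ℝ) : ℂ) ^ s)
      (mellin (fun t ↦ Complex.exp (-((n : ℂ) * t)) / (1 - Complex.exp (-(t : ℂ)))) s) := by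
  have hn' : (0 : ℝ) < n := by exact_mod_cast hn
  refine hasSum_mellin (a := fun _ ↦ 1) (p := fun i : ℕ ↦ (n : ℝ) + i)
    (fun i ↦ Or.inr (by positivity)) (by linarith) (fun t ht ↦ ?_) ?_
  · have hlt : ‖Complex.exp (-(t : ℂ))‖ < 1 := by
      rw [Complex.norm_exp]
      simpa using ht
    have h := (hasSum_geometric_of_norm_lt_one hlt).mul_left (Complex.exp (-((n : ℂ) * t)))
    rw [← div_eq_mul_inv] at h
    refine h.congr_fun ?_
    intro i
    rw [← Complex.exp_nat_mul, ← Complex.exp_add]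
    push_cast
    ring_nf
  · have h := (summable_nat_add_iff n).mpr (Real.summable_one_div_nat_rpow.mpr hs)
    refine h.congr fun i ↦ ?_
    push_cast
    rw [norm_one, add_comm]

theorem sum_cpow_eq_of_re_lt {n : ℕ} (hn : 0 < n) {k : ℂ} (hk : k.re < -1) :
    ∑ j ∈ Finset.Icc 1 n, (j : ℂ) ^ k =
      (n : ℂ) ^ (k + 1) / (k + 1) + (n : ℂ) ^ k / 2 + riemannZeta (-k) -
        2 * (Real.pi : ℂ) * (n : ℂ) ^ (k + 2) / (k + 1) *
          ∫ x in Ioi (0 : ℝ), expIntegrand n k x := by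
  have hs : 1 < (-k).re := by simp; linarith
  have hs1 : 0 < (-k - 1).re := by simp; linarith
  have hk1 : k + 1 ≠ 0 := fun h ↦ by
    have := congrArg Complex.re h
    simp at this
    linarith
  have hk0 : k ≠ 0 := fun h ↦ by rw [h] at hk; simp at hk; linarith
  have hG : Complex.Gamma (-k - 1) ≠ 0 := Complex.Gamma_ne_zero_of_re_pos hs1
  have hGamma : Complex.Gamma (-k) = (-k - 1) * Complex.Gamma (-k - 1) := by
    have h := Complex.Gamma_add_one (-k - 1) (fun h ↦ by rw [h] at hs1; simp at hs1)
    rwa [sub_add_cancel] at h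
  have htail : Complex.Gamma (-k) * ∑' i : ℕ, 1 / ((i + n : ℕ) : ℂ) ^ (-k) =
      Complex.Gamma (-k - 1) * ((n : ℂ) ^ (1 - -k) + (-k - 1) * (n : ℂ) ^ (- -k) / 2 -
        2 * Real.pi * (n : ℂ) ^ (2 - -k) * ∫ x in Ioi (0 : ℝ), expIntegrand n (- -k) x) := by
    rw [← mellin_exp_div_one_sub_exp hn hs, ← (hasSum_zeta_tail hn hs).tsum_eq, ← tsum_mul_left]
    refine tsum_congr fun i ↦ ?_
    push_cast
    rw [add_comm (i : ℂ), mul_div_assoc]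
  have hzeta := Summable.sum_add_tsum_nat_add n (Complex.summable_one_div_nat_cpow.mpr hs)
  rw [← zeta_eq_tsum_one_div_nat_cpow hs] at hzeta
  -- The tail starts at n itself, so the head stops at n - 1 and n^k is added back; the tail's own
  -- n^k/2 reduces this to n^k/2. Index 0 contributes 0 since k ≠ 0.
  have hsum : ∑ j ∈ Finset.Icc 1 n, (j : ℂ) ^ k =
      ∑ i ∈ Finset.range n, 1 / (i : ℂ) ^ (-k) + (n : ℂ) ^ k := by
    have h1 : ∑ i ∈ Finset.range n, 1 / (i : ℂ) ^ (-k) = ∑ i ∈ Finset.range n, (i : ℂ) ^ k :=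
      Finset.sum_congr rfl fun i _ ↦ by rw [Complex.cpow_neg, one_div, inv_inv]
    rw [h1, ← Finset.sum_range_succ (fun i : ℕ ↦ (i : ℂ) ^ k), Finset.sum_range_succ',
      Nat.cast_zero, Complex.zero_cpow hk0, add_zero]
    have h2 := Finset.sum_Ico_eq_sum_range (fun i : ℕ ↦ (i : ℂ) ^ k) 1 (n + 1)
    rw [Nat.add_sub_cancel] at h2
    simp_rw [add_comm 1] at h2
    exact h2
  rw [hsum, ← hzeta]
  rw [hGamma, neg_neg, sub_neg_eq_add, sub_neg_eq_add, add_comm 1 k, add_comm 2 k] at htail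
  have h2 : (-k - 1) * ∑' i : ℕ, 1 / ((i + n : ℕ) : ℂ) ^ (-k) =
      (n : ℂ) ^ (k + 1) + (-k - 1) * (n : ℂ) ^ k / 2 -
        2 * Real.pi * (n : ℂ) ^ (k + 2) * ∫ x in Ioi (0 : ℝ), expIntegrand n k x := by
    refine mul_left_cancel₀ hG ?_
    rw [← htail]; ring
  field_simp
  linear_combination 2 * h2

theorem sum_cpow_eq {n : ℕ} (hn : 0 < n) {k : ℂ} (hk : k ≠ -1) :
    ∑ j ∈ Finset.Icc 1 n, (j : ℂ) ^ k =
      (n : ℂ) ^ (k + 1) / (k + 1) + (n : ℂ) ^ k / 2 + riemannZeta (-k) -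
        2 * (Real.pi : ℂ) * (n : ℂ) ^ (k + 2) / (k + 1) *
          ∫ x in Ioi (0 : ℝ), expIntegrand n k x := by
  have hnC : (n : ℂ) ≠ 0 := by exact_mod_cast hn.ne'
  have hcp : ∀ (c : ℂ), Differentiable ℂ fun k : ℂ ↦ (n : ℂ) ^ (k + c) := fun c ↦
    (differentiable_id.add_const c).const_cpow (Or.inl hnC)
  have hf : AnalyticOnNhd ℂ (fun k : ℂ ↦ ∑ j ∈ Finset.Icc 1 n, (j : ℂ) ^ k) {-1}ᶜ := by
    refine DifferentiableOn.analyticOnNhd (Differentiable.differentiableOn ?_)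
      isOpen_compl_singleton
    refine Differentiable.fun_sum fun j hj ↦ differentiable_id.const_cpow (Or.inl ?_)
    have := (Finset.mem_Icc.mp hj).1
    exact_mod_cast (by omega : j ≠ 0)
  have hg : AnalyticOnNhd ℂ (fun k : ℂ ↦
      (n : ℂ) ^ (k + 1) / (k + 1) + (n : ℂ) ^ k / 2 + riemannZeta (-k) -
        2 * (Real.pi : ℂ) * (n : ℂ) ^ (k + 2) / (k + 1) *
          ∫ x in Ioi (0 : ℝ), expIntegrand n k x) {-1}ᶜ := by
    refine DifferentiableOn.analyticOnNhd (fun k hk ↦ ?_) isOpen_compl_singleton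
    have hk1 : k + 1 ≠ 0 := fun h ↦ hk (eq_neg_of_add_eq_zero_left h)
    have hd : DifferentiableAt ℂ (fun k : ℂ ↦ k + 1) k := by fun_prop
    have hz : DifferentiableAt ℂ (fun k : ℂ ↦ riemannZeta (-k)) k := by
      refine DifferentiableAt.comp k (differentiableAt_riemannZeta fun h ↦ hk ?_) (by fun_prop)
      rw [mem_singleton_iff, ← h, neg_neg]
    have h0 : DifferentiableAt ℂ (fun k : ℂ ↦ (n : ℂ) ^ k) k :=
      differentiableAt_id.const_cpow (Or.inl hnC)
    exact ((((hcp 1 k).div hd hk1).add (h0.div_const 2)).add hz |>.sub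
      ((((hcp 2 k).const_mul _).div hd hk1).mul
        (differentiable_integral_expIntegrand hn k))).differentiableWithinAt
  -- The plane minus a point is connected, and near -2 the formula is the case Re k < -1.
  refine hf.eqOn_of_preconnected_of_eventuallyEq hg
    (isConnected_compl_singleton_of_one_lt_rank (by simp) (-1)).isPreconnected (z₀ := -2)
    (by norm_num) ?_ hk
  have hopen : IsOpen {z : ℂ | z.re < -1} := isOpen_lt Complex.continuous_re continuous_const
  filter_upwards [hopen.mem_nhds (by norm_num : (-2 : ℂ) ∈ {z : ℂ | z.re < -1})] with k hk
  exact sum_cpow_eq_of_re_lt hn hk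

end GenFaulhaber

theorem mainTheorem2 (n : ℕ) (hn : 0 < n) (k : ℂ) (hk : k ≠ -1) :
    (IntervalIntegrable (GenFaulhaber.trigIntegrand n k) MeasureTheory.volume 0 (Real.pi / 2) ∧
      ∑ j ∈ Finset.Icc 1 n, (j : ℂ) ^ k =
        (n : ℂ) ^ (k + 1) / (k + 1) + (n : ℂ) ^ k / 2 + riemannZeta (-k) +
          (Real.pi : ℂ) * (n : ℂ) ^ (k + 2) / (k + 1) *
            ∫ v in (0 : ℝ)..(Real.pi / 2), GenFaulhaber.trigIntegrand n k v) ∧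
    (MeasureTheory.IntegrableOn (GenFaulhaber.expIntegrand n k) (Set.Ioi 0)
        MeasureTheory.volume ∧
      ∑ j ∈ Finset.Icc 1 n, (j : ℂ) ^ k =
        (n : ℂ) ^ (k + 1) / (k + 1) + (n : ℂ) ^ k / 2 + riemannZeta (-k) -
          2 * (Real.pi : ℂ) * (n : ℂ) ^ (k + 2) / (k + 1) *
            ∫ x in Set.Ioi (0 : ℝ), GenFaulhaber.expIntegrand n k x) := by
  have h := GenFaulhaber.sum_cpow_eq hn hk
  refine ⟨⟨GenFaulhaber.intervalIntegrable_trigIntegrand hn k, ?_⟩,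
    GenFaulhaber.integrableOn_expIntegrand hn k, h⟩
  rw [h, GenFaulhaber.integral_trigIntegrand hn k]
  ring
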